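/- Let $N\ge 1$ and $1<p<\infty$. Write $B(0,R)\subset\mathbb{R}^N$ for the open ball of radius $R$ centered at the origin (its inner radius is $R$), and $W_0^{1,p}(B(0,R))$ for the closure of $C_c^\infty(B(0,R))$ in $W^{1,p}(B(0,R))$. A function $u\in W_0^{1,p}(B(0,R))$ is a solution of $$-\Delta_p u = w(x)|u|^{p-2}u \ \text{ in } B(0,R),\qquad u=0 \ \text{ on } \partial B(0,R) \tag{$*$}$$ if, for every $v\in W_0^{1,p}(B(0,R))$, the function $w|u|^{p-2}uv$ is integrable on $B(0,R)$ and $$\int_{B(0,R)}|\nabla u|^{p-2}\nabla u\cdot\nabla v\,dx=\int_{B(0,R)}w|u|^{p-2}u\,v\,dx .$$ 1. Suppose $p>N$ and put $\gamma=p-N$. - For all $\beta<\gamma$ and $C>0$ there is $R_0\ge 1$ such that, for every $R>R_0$, there are a non-negative weight $w\in L^1(B(0,R))$ and a nontrivial solution $u\in W_0^{1,p}(B(0,R))$ of $(*)$ for which the inequality $\frac{C}{R^\beta}\le\|w\|_{L^1(B(0,R))}$ does not hold. - For all $\beta>\gamma$ and $C>0$ there is $R_0\in(0,1]$ such that the same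 is true for every $0<R<R_0$. 2. Suppose $p<N$, let $s>N/p$ be a real number and put $\gamma=\frac{sp-N}{s}$. - For all $\beta<\gamma$ and $C>0$ there is $R_0\ge 1$ such that, for every $R>R_0$, there are a non-negative weight $w\in L^s(B(0,R))$ and a nontrivial solution $u\in W_0^{1,p}(B(0,R))$ of $(*)$ for which the inequality $\frac{C}{R^\beta}\le\|w\|_{L^s(B(0,R))}$ does not hold. - For all $\beta>\gamma$ and $C>0$ there is $R_0\in(0,1]$ such that the same is true for every $0<R<R_0$. - Moreover, for every $R>1$, $\beta<\gamma$ and $C>0$, and for every $0<R<1$, $\beta>\gamma$ and $C>0$, there are a non-negative weight $w\in L^s(B(0,R))$ and a nontrivial solution $u\in W_0^{1,p}(B(0,R))$ of $(*)$ for which the inequality $\frac{C}{R^\beta}\le\|w\|_{L^1(B(0,R))}$ does not hold. -/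

import Mathlib

open MeasureTheory Filter Topology
open scoped ContDiff

namespace Lyapunov

/-- `φ ∈ C_c^∞(Ω)`. -/
def IsTestFunction {N : ℕ} (Ω : Set (EuclideanSpace ℝ (Fin N)))
    (φ : EuclideanSpace ℝ (Fin N) → ℝ) : Prop :=
  ContDiff ℝ ∞ φ ∧ HasCompactSupport φ ∧ tsupport φ ⊆ Ω

/-- `u ∈ L^p(Ω)` has the distributional gradient `G ∈ L^p(Ω; ℝ^N)`; that is, `u ∈ W^{1,p}(Ω)` and
`∇u = G`. Functions live on the whole space, and only their values on `Ω` matter. -/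
structure MemW1p {N : ℕ} (Ω : Set (EuclideanSpace ℝ (Fin N))) (p : ℝ)
    (u : EuclideanSpace ℝ (Fin N) → ℝ)
    (G : EuclideanSpace ℝ (Fin N) → EuclideanSpace ℝ (Fin N)) : Prop where
  memLp : MemLp u (ENNReal.ofReal p) (volume.restrict Ω)
  memLp_grad : MemLp G (ENNReal.ofReal p) (volume.restrict Ω)
  weak_grad : ∀ φ : EuclideanSpace ℝ (Fin N) → ℝ, IsTestFunction Ω φ →
    ∫ x in Ω, u x • gradient φ x = - ∫ x in Ω, φ x • G x

/-- `u ∈ W_0^{1,p}(Ω)` with `∇u = G`, where `W_0^{1,p}(Ω)` is the closure of `C_c^∞(Ω)` in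
`W^{1,p}(Ω)`. -/
structure MemW01p {N : ℕ} (Ω : Set (EuclideanSpace ℝ (Fin N))) (p : ℝ)
    (u : EuclideanSpace ℝ (Fin N) → ℝ)
    (G : EuclideanSpace ℝ (Fin N) → EuclideanSpace ℝ (Fin N)) : Prop
    extends MemW1p Ω p u G where
  approx : ∃ φ : ℕ → EuclideanSpace ℝ (Fin N) → ℝ, (∀ n, IsTestFunction Ω (φ n)) ∧
    Tendsto (fun n => eLpNorm (fun x => u x - φ n x) (ENNReal.ofReal p) (volume.restrict Ω))
      atTop (𝓝 0) ∧
    Tendsto (fun n => eLpNorm (fun x => G x - gradient (φ n) x) (ENNReal.ofReal p)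
      (volume.restrict Ω)) atTop (𝓝 0)

/-- `u ∈ W_0^{1,p}(Ω)` is a weak solution of `-Δ_p u = w |u|^{p-2} u` in `Ω`, `u = 0` on `∂Ω`:
for every `v ∈ W_0^{1,p}(Ω)`, the product `w |u|^{p-2} u v` is integrable on `Ω` and
`∫_Ω |∇u|^{p-2} ∇u · ∇v = ∫_Ω w |u|^{p-2} u v`.
(The left-hand integrand is integrable by Hölder's inequality.) -/
def IsWeakSolution {N : ℕ} (Ω : Set (EuclideanSpace ℝ (Fin N))) (p : ℝ)
    (w u : EuclideanSpace ℝ (Fin N) → ℝ) : Prop :=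
  ∃ G : EuclideanSpace ℝ (Fin N) → EuclideanSpace ℝ (Fin N), MemW01p Ω p u G ∧
    ∀ (v : EuclideanSpace ℝ (Fin N) → ℝ)
      (H : EuclideanSpace ℝ (Fin N) → EuclideanSpace ℝ (Fin N)), MemW01p Ω p v H →
      IntegrableOn (fun x => w x * (|u x| ^ (p - 2) * u x) * v x) Ω ∧
      ∫ x in Ω, inner ℝ (‖G x‖ ^ (p - 2) • G x) (H x) =
        ∫ x in Ω, w x * (|u x| ^ (p - 2) * u x) * v x

/-- On the ball `B(0,R)` of `ℝ^N` there are a non-negative weight `w ∈ L^σ(B(0,R))` and a nontrivial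
solution of the Dirichlet problem for `-Δ_p u = w |u|^{p-2} u` for which the inequality
`C / R^β ≤ ‖w‖_{L^τ(B(0,R))}` does not hold. -/
def LyapunovBoundFails (N : ℕ) (p σ τ C β R : ℝ) : Prop :=
  ∃ w u : EuclideanSpace ℝ (Fin N) → ℝ,
    (∀ x ∈ Metric.ball (0 : EuclideanSpace ℝ (Fin N)) R, 0 ≤ w x) ∧
    MemLp w (ENNReal.ofReal σ) (volume.restrict (Metric.ball 0 R)) ∧
    IsWeakSolution (Metric.ball 0 R) p w u ∧
    (¬ u =ᵐ[volume.restrict (Metric.ball 0 R)] 0) ∧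
    ¬ (ENNReal.ofReal (C / R ^ β) ≤
        eLpNorm w (ENNReal.ofReal τ) (volume.restrict (Metric.ball 0 R)))

end Lyapunov

namespace Lyapunov

/-! The equation is solved backwards: the flux is prescribed, then `u`, then the weight. Fix `ε`
with `2ε ≤ R` and take the flux `|∇u|^{p-2}∇u = -a(|x|²)x`. The field `a(|x|²)x` is a multiple of
`x/|x|^N`, hence divergence-free, for `|x| ≥ ε`. Inside, `a` continues by its tangent line, and the
divergence `f` is bounded, non-negative and supported in the closed ball of radius `ε`. The flux
determines a radial `u` vanishing on the sphere of radius `R`, and `w = f / u^{p-1}` makes `u` a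
solution.

For `|x| ≤ ε` the drop of `u` across `ε ≤ |x| ≤ 2ε` already gives `u^{p-1} ≥ 2^{-N} ε^p`. Hence `w ≤
K ε^{-p}` on a ball of volume `c ε^N`, and `‖w‖_{L^τ} ≤ K c^{1/τ} ε^{N/τ-p}`, with constants
independent of `R` and `ε` (`exists_concentrated_solution`, `exists_const_lyapunovBoundFails`).
Taking `ε = R/2` gives the exponent `-γ`, with `γ = p - N/τ`, which beats `R^{-β}` for large or
small `R` according to the sign of `β - γ`. If `p < N` and `τ = 1`, then `ε → 0` at fixed `R` makes
the norm arbitrarily small.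

The remaining work is to show that `u` lies in `W_0^{1,p}` (`memW01p_integral_norm`) and that the
identity passes from test functions to all of `W_0^{1,p}` (`MemW01p.integral_inner_eq`). -/

/-! ### Radial functions, bounded convergence and cutoffs. -/

theorem hasGradientAt_comp_norm {E : Type*} [NormedAddCommGroup E] [InnerProductSpace ℝ E]
    [CompleteSpace E] {U : ℝ → ℝ} {d : ℝ} {x : E} (hU : HasDerivAt U d ‖x‖)
    (h0 : x = 0 → d = 0) : HasGradientAt (fun y => U ‖y‖) ((d / ‖x‖) • x) x := by
  rcases eq_or_ne x 0 with rfl | hx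
  -- At the origin `d / ‖x‖` is `0` by convention, so the formula is right only because `d = 0`
  -- there.
  · rw [h0 rfl] at hU
    rw [hasGradientAt_iff_isLittleO]
    have h1 := hasDerivAt_iff_isLittleO.1 hU
    have h2 : Tendsto (fun y : E => ‖y‖) (𝓝 0) (𝓝 ‖(0 : E)‖) := continuous_norm.tendsto 0
    have h3 := h1.comp_tendsto h2
    rw [← Asymptotics.isLittleO_norm_right]
    simpa [Function.comp_def] using h3
  · have hn : ‖x‖ ≠ 0 := norm_ne_zero_iff.2 hx
    have h1 : HasFDerivAt (fun y : E => ‖y‖) (‖x‖⁻¹ • innerSL ℝ x) x := by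
      have h := (hasStrictFDerivAt_norm_sq x).hasFDerivAt.sqrt (by positivity)
      simp only [Real.sqrt_sq (norm_nonneg _)] at h
      convert h using 1
      ext y
      simp
      field_simp
    rw [hasGradientAt_iff_hasFDerivAt]
    have h2 := hU.comp_hasFDerivAt x h1
    have h3 : InnerProductSpace.toDual ℝ E ((d / ‖x‖) • x) = d • ‖x‖⁻¹ • innerSL ℝ x := by
      ext y
      simp
      ring
    rw [h3]
    exact h2

theorem tendsto_eLpNorm_zero_of_bounded {α F : Type*} [MeasurableSpace α] [NormedAddCommGroup F]
    {μ : Measure α} [IsFiniteMeasure μ] {p : ℝ} (hp : 0 < p) {f : ℕ → α → F} {C : ℝ}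
    (hm : ∀ n, AEStronglyMeasurable (f n) μ) (hb : ∀ n, ∀ᵐ x ∂μ, ‖f n x‖ ≤ C)
    (hl : ∀ᵐ x ∂μ, Tendsto (fun n => f n x) atTop (𝓝 0)) :
    Tendsto (fun n => eLpNorm (f n) (ENNReal.ofReal p) μ) atTop (𝓝 0) := by
  have hp0 : ENNReal.ofReal p ≠ 0 := by simpa using hp
  simp_rw [eLpNorm_eq_lintegral_rpow_enorm_toReal hp0 ENNReal.ofReal_ne_top,
    ENNReal.toReal_ofReal hp.le]
  have key : Tendsto (fun n => ∫⁻ x, ‖f n x‖ₑ ^ p ∂μ) atTop (𝓝 (∫⁻ _, 0 ∂μ)) := by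
    refine tendsto_lintegral_of_dominated_convergence' (fun _ => ENNReal.ofReal C ^ p)
      (fun n => (hm n).enorm.pow_const p) (fun n => ?_) ?_ ?_
    · filter_upwards [hb n] with x hx
      gcongr
      rw [← ofReal_norm]
      exact ENNReal.ofReal_le_ofReal hx
    · rw [lintegral_const]
      exact ENNReal.mul_ne_top (ENNReal.rpow_ne_top_of_nonneg hp.le ENNReal.ofReal_ne_top)
        (measure_ne_top _ _)
    · filter_upwards [hl] with x hx
      have h1 : Tendsto (fun n => ‖f n x‖ₑ) atTop (𝓝 0) := by simpa using hx.enorm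
      simpa [hp, Function.comp_def] using
        ((ENNReal.continuous_rpow_const (y := p)).tendsto 0).comp h1
  rw [lintegral_zero] at key
  have := ((ENNReal.continuous_rpow_const (y := 1 / p)).tendsto 0).comp key
  simpa [Function.comp_def, hp] using this

/-- A continuous function is on `(0, R)` a bounded pointwise limit of functions in
`C_c^∞((0, R))`. -/
theorem exists_smooth_cutoff_approx {g : ℝ → ℝ} (hg : Continuous g) {R : ℝ} (hR : 0 < R) :
    ∃ (k : ℕ → ℝ → ℝ) (C : ℝ), (∀ n, ContDiff ℝ ∞ (k n)) ∧
      (∀ n, ∃ δ > 0, (∀ r ≤ δ, k n r = 0) ∧ (∀ r ≥ R - δ, k n r = 0)) ∧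
      (∀ n, ∀ r ∈ Set.Icc 0 R, |g r - k n r| ≤ C) ∧
      (∀ r ∈ Set.Ioo 0 R, Tendsto (fun n => g r - k n r) atTop (𝓝 0)) := by
  obtain ⟨M, hM⟩ := isCompact_Icc.exists_bound_of_continuousOn (s := Set.Icc 0 R) hg.continuousOn
  have hP : ∀ n : ℕ, ∃ P : Polynomial ℝ, ∀ x ∈ Set.Icc 0 R, |P.eval x - g x| < 1 / ((n : ℝ) + 1) :=
    fun n => exists_polynomial_near_of_continuousOn 0 R g hg.continuousOn _ (by positivity)
  choose P hP using hP
  let δ : ℕ → ℝ := fun n => R / (n + 3)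
  have hδ : ∀ n, 0 < δ n := fun n => by positivity
  -- The cutoff equals `1` on `[2δ, R - 2δ]` and `0` outside `[δ, R - δ]`; it multiplies a
  -- polynomial close to `g` on `[0, R]`.
  let χ : ℕ → ℝ → ℝ := fun n r =>
    Real.smoothTransition ((r - δ n) / δ n) * Real.smoothTransition ((R - δ n - r) / δ n)
  have hχ0 : ∀ n r, 0 ≤ χ n r := fun n r =>
    mul_nonneg (Real.smoothTransition.nonneg _) (Real.smoothTransition.nonneg _)
  have hχ1 : ∀ n r, χ n r ≤ 1 := fun n r =>
    mul_le_one₀ (Real.smoothTransition.le_one _) (Real.smoothTransition.nonneg _)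
      (Real.smoothTransition.le_one _)
  have hest : ∀ n r, r ∈ Set.Icc 0 R → |g r - χ n r * (P n).eval r| ≤
      1 / ((n : ℝ) + 1) + (1 - χ n r) * |g r| := by
    intro n r hr
    have h1 := (hP n r hr).le
    have h2 : g r - χ n r * (P n).eval r = -(χ n r * ((P n).eval r - g r)) + (1 - χ n r) * g r := by
      ring
    rw [h2]
    refine (abs_add_le _ _).trans ?_
    rw [abs_neg, abs_mul (χ n r), abs_mul (1 - χ n r), abs_of_nonneg (hχ0 n r),
      abs_of_nonneg (sub_nonneg.2 (hχ1 n r))]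
    gcongr
    exact (mul_le_of_le_one_left (abs_nonneg _) (hχ1 n r)).trans h1
  refine ⟨fun n r => χ n r * (P n).eval r, 1 + M, fun n => ?_, fun n => ⟨δ n, hδ n, ?_, ?_⟩, ?_, ?_⟩
  · have h1 : ContDiff ℝ ∞ (fun r : ℝ => (P n).eval r) := by
      simpa using (P n).contDiff_aeval (𝕜 := ℝ) (n := ∞)
    refine ContDiff.mul (ContDiff.mul ?_ ?_) h1
    · exact Real.smoothTransition.contDiff.comp (by fun_prop)
    · exact Real.smoothTransition.contDiff.comp (by fun_prop)
  · intro r hr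
    have : Real.smoothTransition ((r - δ n) / δ n) = 0 :=
      Real.smoothTransition.zero_of_nonpos (div_nonpos_of_nonpos_of_nonneg (by linarith) (hδ n).le)
    simp [χ, this]
  · intro r hr
    have : Real.smoothTransition ((R - δ n - r) / δ n) = 0 :=
      Real.smoothTransition.zero_of_nonpos (div_nonpos_of_nonpos_of_nonneg (by linarith) (hδ n).le)
    simp [χ, this]
  · intro n r hr
    refine (hest n r hr).trans (add_le_add ?_ ?_)
    · rw [div_le_one (by positivity)]
      linarith [(Nat.cast_nonneg n : (0 : ℝ) ≤ n)]
    · exact (mul_le_of_le_one_left (abs_nonneg _) (by linarith [hχ0 n r])).trans (hM r hr)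
  · intro r hr
    have hδ0 : Tendsto δ atTop (𝓝 0) :=
      tendsto_const_nhds.div_atTop (tendsto_atTop_add_const_right _ _ tendsto_natCast_atTop_atTop)
    refine squeeze_zero_norm' (a := fun n : ℕ => 1 / ((n : ℝ) + 1)) ?_
      tendsto_one_div_add_atTop_nhds_zero_nat
    have e1 : ∀ᶠ n in atTop, δ n < r / 2 := hδ0.eventually_lt_const (by linarith [hr.1])
    have e2 : ∀ᶠ n in atTop, δ n < (R - r) / 2 := hδ0.eventually_lt_const (by linarith [hr.2])
    filter_upwards [e1, e2] with n h1 h2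
    have : χ n r = 1 := by
      simp only [χ]
      rw [Real.smoothTransition.one_of_one_le, Real.smoothTransition.one_of_one_le, one_mul]
      · rw [le_div_iff₀ (hδ n)]; linarith
      · rw [le_div_iff₀ (hδ n)]; linarith
    have h := hest n r ⟨hr.1.le, hr.2.le⟩
    rw [this] at h ⊢
    simpa using h

theorem norm_div_norm_smul {E : Type*} [NormedAddCommGroup E] [NormedSpace ℝ E] {h : ℝ → ℝ}
    (h0 : h 0 = 0) (x : E) : ‖(h ‖x‖ / ‖x‖) • x‖ = |h ‖x‖| := by
  rcases eq_or_ne x 0 with rfl | hx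
  · simp [h0]
  · have hn : ‖x‖ ≠ 0 := norm_ne_zero_iff.2 hx
    rw [norm_smul, norm_div, norm_norm, Real.norm_eq_abs, div_mul_cancel₀ _ hn]

theorem continuous_div_norm_smul {E : Type*} [NormedAddCommGroup E] [NormedSpace ℝ E] {h : ℝ → ℝ}
    (hc : Continuous h) (h0 : h 0 = 0) : Continuous (fun x : E => (h ‖x‖ / ‖x‖) • x) := by
  rw [continuous_iff_continuousAt]
  intro x
  rcases eq_or_ne x 0 with rfl | hx
  · rw [ContinuousAt, smul_zero, tendsto_zero_iff_norm_tendsto_zero]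
    simp_rw [norm_div_norm_smul h0]
    have : Continuous fun y : E => |h ‖y‖| := by fun_prop
    simpa [h0] using this.tendsto 0
  · have hn : ‖x‖ ≠ 0 := norm_ne_zero_iff.2 hx
    fun_prop (disch := exact hn)

/-! ### Test functions and integration by parts. -/

theorem IsTestFunction.continuous_gradient {N : ℕ} {Ω : Set (EuclideanSpace ℝ (Fin N))}
    {φ : EuclideanSpace ℝ (Fin N) → ℝ} (hφ : IsTestFunction Ω φ) : Continuous (gradient φ) :=
  (InnerProductSpace.toDual ℝ _).symm.continuous.comp (hφ.1.continuous_fderiv (by simp))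

theorem IsTestFunction.hasCompactSupport_gradient {N : ℕ} {Ω : Set (EuclideanSpace ℝ (Fin N))}
    {φ : EuclideanSpace ℝ (Fin N) → ℝ} (hφ : IsTestFunction Ω φ) :
    HasCompactSupport (gradient φ) :=
  (hφ.2.1.fderiv (𝕜 := ℝ)).comp_left (map_zero _)

theorem IsTestFunction.integrable_smul_gradient {N : ℕ} {Ω : Set (EuclideanSpace ℝ (Fin N))}
    {u φ : EuclideanSpace ℝ (Fin N) → ℝ} (hφ : IsTestFunction Ω φ) (hu : Continuous u) :
    Integrable fun x => u x • gradient φ x :=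
  (hu.smul hφ.continuous_gradient).integrable_of_hasCompactSupport
    hφ.hasCompactSupport_gradient.smul_left

theorem IsTestFunction.integrable_smul {N : ℕ} {Ω : Set (EuclideanSpace ℝ (Fin N))}
    {φ : EuclideanSpace ℝ (Fin N) → ℝ} {G : EuclideanSpace ℝ (Fin N) → EuclideanSpace ℝ (Fin N)}
    (hφ : IsTestFunction Ω φ) (hG : Continuous G) : Integrable fun x => φ x • G x :=
  (hφ.1.continuous.smul hG).integrable_of_hasCompactSupport hφ.2.1.smul_right

/-- Integration by parts of a `C^1` function against a test function. -/
theorem setIntegral_smul_gradient_eq_neg {N : ℕ} {Ω : Set (EuclideanSpace ℝ (Fin N))}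
    {u φ : EuclideanSpace ℝ (Fin N) → ℝ} {G : EuclideanSpace ℝ (Fin N) → EuclideanSpace ℝ (Fin N)}
    (hG : Continuous G) (hu : ∀ x, HasGradientAt u (G x) x) (hφ : IsTestFunction Ω φ) :
    ∫ x in Ω, u x • gradient φ x = - ∫ x in Ω, φ x • G x := by
  have huc : Continuous u :=
    continuous_iff_continuousAt.2 fun x => (hu x).differentiableAt.continuousAt
  have i1 := hφ.integrable_smul_gradient huc
  have i2 := hφ.integrable_smul hG
  obtain ⟨hd, hc, hs⟩ := hφ
  have hφd : Differentiable ℝ φ := hd.differentiable (by simp)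
  have hφ0 : ∀ x, x ∉ Ω → φ x = 0 := fun x hx => image_eq_zero_of_notMem_tsupport fun h => hx (hs h)
  have hg0 : ∀ x, x ∉ Ω → gradient φ x = 0 := fun x hx => by
    have : fderiv ℝ φ x = 0 := fderiv_of_notMem_tsupport ℝ fun h => hx (hs h)
    simp [gradient, this]
  rw [setIntegral_eq_integral_of_forall_compl_eq_zero fun x hx => by simp [hg0 x hx],
    setIntegral_eq_integral_of_forall_compl_eq_zero fun x hx => by simp [hφ0 x hx]]
  refine ext_inner_left ℝ fun v => ?_
  rw [inner_neg_right, ← integral_inner i1, ← integral_inner i2]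
  have e1 : ∀ x, inner ℝ v (u x • gradient φ x) = u x * fderiv ℝ φ x v := fun x => by
    rw [inner_smul_right, inner_gradient_right]; simp
  have e2 : ∀ x, inner ℝ v (φ x • G x) = fderiv ℝ u x v * φ x := fun x => by
    rw [inner_smul_right, (hu x).fderiv_apply, real_inner_comm, mul_comm]
  have j1 := i1.const_inner (𝕜 := ℝ) v
  have j2 := i2.const_inner (𝕜 := ℝ) v
  simp_rw [e1] at j1 ⊢
  simp_rw [e2] at j2 ⊢
  exact integral_mul_fderiv_eq_neg_fderiv_mul_of_integrable j2 j1
    ((huc.mul hd.continuous).integrable_of_hasCompactSupport hc.mul_left)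
    (fun x _ => (hu x).differentiableAt) fun x _ => hφd x

/-! ### Radial primitives as elements of `W_0^{1,p}`. -/

theorem hasDerivAt_integral_left {g : ℝ → ℝ} (hg : Continuous g) (R r : ℝ) :
    HasDerivAt (fun r => ∫ t in r..R, g t) (-g r) r :=
  intervalIntegral.integral_hasDerivAt_left (hg.intervalIntegrable _ _)
    (hg.stronglyMeasurableAtFilter _ _) hg.continuousAt

theorem hasGradientAt_integral_norm {N : ℕ} {g : ℝ → ℝ} (hg : Continuous g) (g0 : g 0 = 0) (R : ℝ)
    (x : EuclideanSpace ℝ (Fin N)) :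
    HasGradientAt (fun x : EuclideanSpace ℝ (Fin N) => ∫ t in ‖x‖..R, g t)
      ((-g ‖x‖ / ‖x‖) • x) x :=
  hasGradientAt_comp_norm (hasDerivAt_integral_left hg R ‖x‖) fun h => by simp [h, g0]

/-- As `k` vanishes near `0`, the function is constant near the origin, where the norm is not
smooth; as `k` vanishes from `R - δ` on, the support stays inside the ball. -/
theorem isTestFunction_integral_norm {N : ℕ} {k : ℝ → ℝ} (hk : ContDiff ℝ ∞ k) {R δ : ℝ}
    (hδ : 0 < δ) (h0 : ∀ r ≤ δ, k r = 0) (h1 : ∀ r ≥ R - δ, k r = 0) :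
    IsTestFunction (Metric.ball 0 R)
      (fun x : EuclideanSpace ℝ (Fin N) => ∫ t in ‖x‖..R, k t) := by
  have hU : ContDiff ℝ ∞ fun r => ∫ t in r..R, k t := by
    rw [contDiff_infty_iff_deriv]
    refine ⟨fun r => (hasDerivAt_integral_left hk.continuous R r).differentiableAt, ?_⟩
    have : deriv (fun r => ∫ t in r..R, k t) = fun r => -k r :=
      funext fun r => (hasDerivAt_integral_left hk.continuous R r).deriv
    rw [this]
    exact hk.neg
  have hz : ∀ x : EuclideanSpace ℝ (Fin N), x ∉ Metric.closedBall 0 (R - δ) →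
      ∫ t in ‖x‖..R, k t = 0 := by
    intro x hx
    have hx' : R - δ < ‖x‖ := by simpa using hx
    rw [intervalIntegral.integral_congr (g := fun _ => 0), intervalIntegral.integral_zero]
    intro t ht
    refine h1 t ?_
    have := ht.1
    rcases le_total ‖x‖ R with h | h
    · rw [inf_eq_left.2 h] at this; linarith
    · rw [inf_eq_right.2 h] at this; linarith
  refine ⟨contDiff_iff_contDiffAt.2 fun x => ?_,
    HasCompactSupport.intro (isCompact_closedBall 0 (R - δ)) hz, ?_⟩
  · rcases eq_or_ne x 0 with rfl | hx
    · have : (fun x : EuclideanSpace ℝ (Fin N) => ∫ t in ‖x‖..R, k t) =ᶠ[𝓝 0]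
          fun _ => ∫ t in (0 : ℝ)..R, k t := by
        filter_upwards [Metric.ball_mem_nhds (0 : EuclideanSpace ℝ (Fin N)) hδ] with x hx
        have hx' : ‖x‖ < δ := by simpa using hx
        rw [← intervalIntegral.integral_add_adjacent_intervals
          (hk.continuous.intervalIntegrable 0 ‖x‖) (hk.continuous.intervalIntegrable ‖x‖ R),
          intervalIntegral.integral_congr (a := 0) (b := ‖x‖) (g := fun _ => 0),
          intervalIntegral.integral_zero, zero_add]
        intro t ht
        rw [Set.uIcc_of_le (norm_nonneg _)] at ht
        exact h0 t (ht.2.trans hx'.le)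
      exact contDiffAt_const.congr_of_eventuallyEq this
    · exact hU.contDiffAt.comp x (contDiffAt_norm ℝ hx)
  · refine (closure_minimal (fun x hx => ?_) Metric.isClosed_closedBall).trans
      (Metric.closedBall_subset_ball (by linarith : R - δ < R))
    by_contra h
    exact hx (hz x h)

/-- The cutoff is applied to the radial derivative `g`, not to the function. Integrating the cut-off
profiles gives test functions whose gradients converge boundedly almost everywhere, and the
functions follow by integration. The condition `g 0 = 0` makes the gradient continuous at the
origin. -/
theorem memW01p_integral_norm {N : ℕ} {p : ℝ} (hp : 0 < p) {g : ℝ → ℝ} (hg : Continuous g)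
    (g0 : g 0 = 0) {R : ℝ} (hR : 0 < R) :
    MemW01p (Metric.ball 0 R) p (fun x : EuclideanSpace ℝ (Fin N) => ∫ t in ‖x‖..R, g t)
      (fun x => (-g ‖x‖ / ‖x‖) • x) := by
  have hGc : Continuous fun x : EuclideanSpace ℝ (Fin N) => (-g ‖x‖ / ‖x‖) • x :=
    continuous_div_norm_smul hg.neg (by simp [g0])
  have hUc : ∀ {g : ℝ → ℝ}, Continuous g →
      Continuous fun x : EuclideanSpace ℝ (Fin N) => ∫ t in ‖x‖..R, g t := fun {g} hg =>
    (continuous_iff_continuousAt.2 fun r => (hasDerivAt_integral_left hg R r).continuousAt).comp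
      continuous_norm
  have : IsFiniteMeasure (volume.restrict (Metric.ball (0 : EuclideanSpace ℝ (Fin N)) R)) :=
    ⟨by simpa using measure_ball_lt_top⟩
  have hmem : ∀ {F : Type} [NormedAddCommGroup F] {f : EuclideanSpace ℝ (Fin N) → F},
      Continuous f → MemLp f (ENNReal.ofReal p) (volume.restrict (Metric.ball 0 R)) := by
    intro F _ f hf
    obtain ⟨C, hC⟩ := (isCompact_closedBall (0 : EuclideanSpace ℝ (Fin N)) R).exists_bound_of_continuousOn
      hf.continuousOn
    refine MemLp.of_bound hf.aestronglyMeasurable C ?_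
    filter_upwards [ae_restrict_mem measurableSet_ball] with x hx
    exact hC x (Metric.ball_subset_closedBall hx)
  obtain ⟨k, C, hk, hδ, hb, hl⟩ := exists_smooth_cutoff_approx hg hR
  choose δ hδ h0 h1 using hδ
  have hk0 : ∀ n, k n 0 = 0 := fun n => h0 n 0 (hδ n).le
  refine ⟨⟨hmem (hUc hg), hmem hGc, fun φ hφ => setIntegral_smul_gradient_eq_neg hGc
    (hasGradientAt_integral_norm hg g0 R) hφ⟩, fun n x => ∫ t in ‖x‖..R, k n t,
    fun n => isTestFunction_integral_norm (hk n) (hδ n) (h0 n) (h1 n), ?_, ?_⟩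
  · refine tendsto_eLpNorm_zero_of_bounded hp (C := C * R)
      (fun n => ((hUc hg).sub (hUc (hk n).continuous)).aestronglyMeasurable) (fun n => ?_) ?_
    · filter_upwards [ae_restrict_mem measurableSet_ball] with x hx
      have hx' : ‖x‖ < R := by simpa using hx
      rw [← intervalIntegral.integral_sub (hg.intervalIntegrable _ _)
        ((hk n).continuous.intervalIntegrable _ _)]
      refine (intervalIntegral.norm_integral_le_of_norm_le_const (C := C) fun t ht => ?_).trans ?_
      · rw [Set.uIoc_of_le hx'.le] at ht
        exact hb n t ⟨(norm_nonneg _).trans ht.1.le, ht.2⟩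
      · have hC : 0 ≤ C := (abs_nonneg _).trans (hb 0 0 ⟨le_rfl, hR.le⟩)
        rw [abs_of_nonneg (by linarith)]
        gcongr
        linarith [norm_nonneg x]
    · filter_upwards [ae_restrict_mem measurableSet_ball] with x hx
      have hx' : ‖x‖ < R := by simpa using hx
      have hsub : ∀ n, (∫ t in ‖x‖..R, g t) - ∫ t in ‖x‖..R, k n t =
          ∫ t in ‖x‖..R, (g t - k n t) := fun n =>
        (intervalIntegral.integral_sub (hg.intervalIntegrable ‖x‖ R)
          ((hk n).continuous.intervalIntegrable _ _)).symm
      simp only [hsub]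
      rw [← intervalIntegral.integral_zero (a := ‖x‖) (b := R) (μ := volume) (E := ℝ)]
      refine intervalIntegral.tendsto_integral_filter_of_dominated_convergence (fun _ => C)
        (Eventually.of_forall fun n => (hg.sub (hk n).continuous).aestronglyMeasurable)
        (Eventually.of_forall fun n => Eventually.of_forall fun t ht => ?_)
        intervalIntegrable_const ?_
      · rw [Set.uIoc_of_le hx'.le] at ht
        exact hb n t ⟨(norm_nonneg _).trans ht.1.le, ht.2⟩
      -- The profiles converge only on the open interval, so the endpoint `t = R` is discarded as a
      -- null set.
      · filter_upwards [(Set.countable_singleton R).ae_notMem volume] with t htR ht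
        rw [Set.uIoc_of_le hx'.le] at ht
        exact hl t ⟨(norm_nonneg _).trans_lt ht.1, lt_of_le_of_ne ht.2 htR⟩
  · have hgr : ∀ n (x : EuclideanSpace ℝ (Fin N)), (-g ‖x‖ / ‖x‖) • x -
        gradient (fun x : EuclideanSpace ℝ (Fin N) => ∫ t in ‖x‖..R, k n t) x =
        ((fun r => -(g r - k n r)) ‖x‖ / ‖x‖) • x := fun n x => by
      rw [(hasGradientAt_integral_norm (hk n).continuous (hk0 n) R x).gradient, ← sub_smul]
      congr 1
      ring
    have hz : ∀ n, (fun r => -(g r - k n r)) 0 = 0 := fun n => by simp [g0, hk0]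
    simp_rw [hgr]
    refine tendsto_eLpNorm_zero_of_bounded hp (C := C) (fun n => Continuous.aestronglyMeasurable ?_)
      (fun n => ?_) ?_
    · exact continuous_div_norm_smul (hg.sub (hk n).continuous).neg (hz n)
    · filter_upwards [ae_restrict_mem measurableSet_ball] with x hx
      have hx' : ‖x‖ < R := by simpa using hx
      refine (norm_div_norm_smul (h := fun r => -(g r - k n r)) (hz n) x).trans_le ?_
      rw [abs_neg]
      exact hb n _ ⟨norm_nonneg _, hx'.le⟩
    · filter_upwards [ae_restrict_mem measurableSet_ball] with x hx
      have hx' : ‖x‖ < R := by simpa using hx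
      rcases eq_or_ne x 0 with rfl | h
      · simp
      · have := (hl ‖x‖ ⟨norm_pos_iff.2 h, hx'⟩).neg
        simpa using (this.div_const ‖x‖).smul_const x

/-! ### The divergence of a radial vector field. -/

theorem hasGradientAt_comp_norm_sq_mul {N : ℕ} {a : ℝ → ℝ} {d : ℝ} (i : Fin N)
    (x : EuclideanSpace ℝ (Fin N)) (ha : HasDerivAt a d (‖x‖ ^ 2)) :
    HasGradientAt (fun y : EuclideanSpace ℝ (Fin N) => a (‖y‖ ^ 2) * y i)
      (a (‖x‖ ^ 2) • EuclideanSpace.single i 1 + (2 * d * x i) • x) x := by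
  rw [hasGradientAt_iff_hasFDerivAt]
  have h1 := ha.comp_hasFDerivAt x (hasStrictFDerivAt_norm_sq x).hasFDerivAt
  have h2 := h1.mul (EuclideanSpace.proj (𝕜 := ℝ) i).hasFDerivAt
  refine h2.congr_fderiv ?_
  ext y
  simp [EuclideanSpace.inner_single_left]
  ring

/-- The divergence theorem for `x ↦ a(|x|²) x`, tested against `φ`. -/
theorem setIntegral_inner_smul_gradient_eq_neg {N : ℕ} {Ω : Set (EuclideanSpace ℝ (Fin N))}
    {a a' : ℝ → ℝ} (ha : ∀ t, HasDerivAt a (a' t) t) (ha' : Continuous a')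
    {φ : EuclideanSpace ℝ (Fin N) → ℝ} (hφ : IsTestFunction Ω φ) :
    ∫ x in Ω, inner ℝ (a (‖x‖ ^ 2) • x) (gradient φ x) =
      - ∫ x in Ω, (N * a (‖x‖ ^ 2) + 2 * ‖x‖ ^ 2 * a' (‖x‖ ^ 2)) * φ x := by
  have hac : Continuous a := continuous_iff_continuousAt.2 fun t => (ha t).continuousAt
  let e : Fin N → EuclideanSpace ℝ (Fin N) := fun i => EuclideanSpace.single i 1
  let G : Fin N → EuclideanSpace ℝ (Fin N) → EuclideanSpace ℝ (Fin N) := fun i x =>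
    a (‖x‖ ^ 2) • e i + (2 * a' (‖x‖ ^ 2) * x i) • x
  have hV : ∀ i, Continuous fun x : EuclideanSpace ℝ (Fin N) => a (‖x‖ ^ 2) * x i := fun i => by
    fun_prop
  have hG : ∀ i, Continuous (G i) := fun i => by
    simp only [G]
    fun_prop
  have i1 := fun i => (hφ.integrable_smul_gradient (hV i)).integrableOn (s := Ω)
  have i2 := fun i => (hφ.integrable_smul (hG i)).integrableOn (s := Ω)
  -- Integration by parts for the `i`-th component of the field; only the `i`-th partial derivative
  -- is kept, and the sum over `i` is the divergence.
  have key : ∀ i, ∫ x in Ω, inner ℝ (e i) ((a (‖x‖ ^ 2) * x i) • gradient φ x) =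
      - ∫ x in Ω, inner ℝ (e i) (φ x • G i x) := fun i => by
    rw [integral_inner (i1 i), integral_inner (i2 i), ← inner_neg_right,
      setIntegral_smul_gradient_eq_neg (hG i)
        (fun x => hasGradientAt_comp_norm_sq_mul i x (ha _)) hφ]
  have h1 : ∀ x : EuclideanSpace ℝ (Fin N), inner ℝ (a (‖x‖ ^ 2) • x) (gradient φ x) =
      ∑ i, inner ℝ (e i) ((a (‖x‖ ^ 2) * x i) • gradient φ x) := fun x => by
    generalize gradient φ x = y
    simp [PiLp.inner_apply, e, mul_comm, mul_left_comm]
  have h2 : ∀ x : EuclideanSpace ℝ (Fin N),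
      (N * a (‖x‖ ^ 2) + 2 * ‖x‖ ^ 2 * a' (‖x‖ ^ 2)) * φ x =
      ∑ i, inner ℝ (e i) (φ x • G i x) := fun x => by
    have : ‖x‖ ^ 2 = ∑ i, x i ^ 2 := by simp [EuclideanSpace.norm_sq_eq]
    have h3 : ∀ i, inner ℝ (e i) (φ x • G i x) =
        φ x * a (‖x‖ ^ 2) + 2 * a' (‖x‖ ^ 2) * φ x * x i ^ 2 := fun i => by
      simp [e, G, EuclideanSpace.inner_single_left]
      ring
    simp_rw [h3]
    rw [Finset.sum_add_distrib, Finset.sum_const, ← Finset.mul_sum, ← this]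
    simp
    ring
  simp_rw [h1, h2]
  rw [integral_finsetSum _ fun i _ => (i1 i).const_inner _,
    integral_finsetSum _ fun i _ => (i2 i).const_inner _, ← Finset.sum_neg_distrib]
  exact Finset.sum_congr rfl fun i _ => key i

/-! ### From test functions to `W_0^{1,p}`. -/

/-- On a finite measure space `L^p` convergence implies `L^1` convergence, and pairing with a
bounded field is continuous on `L^1`. -/
theorem tendsto_integral_inner_of_eLpNorm {α F : Type*} [MeasurableSpace α] {μ : Measure α}
    [IsFiniteMeasure μ] [NormedAddCommGroup F] [InnerProductSpace ℝ F] {p : ENNReal} (hp : 1 ≤ p)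
    {b v : α → F} {φ : ℕ → α → F} {C : ℝ} (hb : AEStronglyMeasurable b μ)
    (hbC : ∀ᵐ x ∂μ, ‖b x‖ ≤ C) (hv : MemLp v p μ) (hφ : ∀ n, MemLp (φ n) p μ)
    (h : Tendsto (fun n => eLpNorm (fun x => v x - φ n x) p μ) atTop (𝓝 0)) :
    Integrable (fun x => inner ℝ (b x) (v x)) μ ∧
      Tendsto (fun n => ∫ x, inner ℝ (b x) (φ n x) ∂μ) atTop (𝓝 (∫ x, inner ℝ (b x) (v x) ∂μ)) := by
  have hint : ∀ {f : α → F}, MemLp f p μ → Integrable (fun x => inner ℝ (b x) (f x)) μ := by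
    intro f hf
    refine ((hf.integrable hp).norm.const_mul C).mono' (hb.inner hf.1) ?_
    filter_upwards [hbC] with x hx
    exact (norm_inner_le_norm _ _).trans (by gcongr)
  refine ⟨hint hv, tendsto_integral_of_L1' _ (hint hv).1 (Eventually.of_forall fun n => hint (hφ n)) ?_⟩
  have hbound : ∀ n, eLpNorm ((fun x => inner ℝ (b x) (φ n x)) - fun x => inner ℝ (b x) (v x)) 1 μ ≤
      ENNReal.ofReal C * (eLpNorm (fun x => v x - φ n x) p μ *
        μ Set.univ ^ (1 / (1 : ENNReal).toReal - 1 / p.toReal)) := by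
    intro n
    refine (eLpNorm_le_mul_eLpNorm_of_ae_le_mul (g := fun x => v x - φ n x) (c := C) ?_ 1).trans ?_
    · filter_upwards [hbC] with x hx
      rw [Pi.sub_apply, ← inner_sub_right, norm_sub_rev]
      exact (norm_inner_le_norm _ _).trans (by gcongr)
    · gcongr
      exact eLpNorm_le_eLpNorm_mul_rpow_measure_univ hp (hv.1.sub (hφ n).1)
  refine tendsto_of_tendsto_of_tendsto_of_le_of_le tendsto_const_nhds ?_ (fun _ => zero_le) hbound
  have hfin : μ Set.univ ^ (1 / (1 : ENNReal).toReal - 1 / p.toReal) ≠ ⊤ := by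
    refine ENNReal.rpow_ne_top_of_nonneg ?_ (measure_ne_top _ _)
    rcases eq_or_ne p ⊤ with rfl | hpt
    · simp
    · have : 1 ≤ p.toReal := by simpa using ENNReal.toReal_mono hpt hp
      simpa using inv_le_one_of_one_le₀ this
  simpa using ENNReal.Tendsto.const_mul (ENNReal.Tendsto.mul_const h (Or.inr hfin))
    (Or.inr (ENNReal.ofReal_ne_top (r := C)))

/-- An identity `∫ V · ∇φ = ∫ f φ` extends from test functions to `W_0^{1,p}`. -/
theorem MemW01p.integral_inner_eq {N : ℕ} {Ω : Set (EuclideanSpace ℝ (Fin N))} {p : ℝ} (hp : 1 ≤ p)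
    (hΩ : volume Ω ≠ ⊤) {v : EuclideanSpace ℝ (Fin N) → ℝ}
    {H : EuclideanSpace ℝ (Fin N) → EuclideanSpace ℝ (Fin N)} (hv : MemW01p Ω p v H)
    {V : EuclideanSpace ℝ (Fin N) → EuclideanSpace ℝ (Fin N)}
    {f : EuclideanSpace ℝ (Fin N) → ℝ} {C D : ℝ}
    (hV : AEStronglyMeasurable V (volume.restrict Ω)) (hVC : ∀ᵐ x ∂volume.restrict Ω, ‖V x‖ ≤ C)
    (hf : AEStronglyMeasurable f (volume.restrict Ω)) (hfD : ∀ᵐ x ∂volume.restrict Ω, ‖f x‖ ≤ D)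
    (h : ∀ φ, IsTestFunction Ω φ → ∫ x in Ω, inner ℝ (V x) (gradient φ x) = ∫ x in Ω, f x * φ x) :
    IntegrableOn (fun x => f x * v x) Ω ∧
      ∫ x in Ω, inner ℝ (V x) (H x) = ∫ x in Ω, f x * v x := by
  have : IsFiniteMeasure (volume.restrict Ω) := ⟨by simpa using hΩ.lt_top⟩
  obtain ⟨φ, hφ, h1, h2⟩ := hv.approx
  have hp' : 1 ≤ ENNReal.ofReal p := by simpa using hp
  have m1 : ∀ n, MemLp (φ n) (ENNReal.ofReal p) (volume.restrict Ω) := fun n =>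
    ((hφ n).1.continuous.memLp_of_hasCompactSupport (hφ n).2.1).restrict Ω
  have m2 : ∀ n, MemLp (gradient (φ n)) (ENNReal.ofReal p) (volume.restrict Ω) := fun n =>
    ((hφ n).continuous_gradient.memLp_of_hasCompactSupport
      (hφ n).hasCompactSupport_gradient).restrict Ω
  have t1 := tendsto_integral_inner_of_eLpNorm hp' hf hfD hv.memLp m1 h1
  have t2 := tendsto_integral_inner_of_eLpNorm hp' hV hVC hv.memLp_grad m2 h2
  have e : ∀ s t : ℝ, inner ℝ s t = s * t := fun s t => by simp [mul_comm]
  simp_rw [e] at t1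
  refine ⟨t1.1, tendsto_nhds_unique t2.2 ?_⟩
  simp_rw [fun n => h (φ n) (hφ n)]
  exact t1.2

/-! ### The profile of the flux, in the variable `τ = |x|²/ε²`. -/

/-- `τ ↦ τ^{-N/2}`, continued to `τ ≤ 1` by its tangent line at `1`. -/
noncomputable def decay (N : ℕ) (τ : ℝ) : ℝ :=
  if τ ≤ 1 then 1 - (N / 2 : ℝ) * (τ - 1) else τ ^ (-(N / 2 : ℝ))

/-- The derivative of `decay`. -/
noncomputable def decayDeriv (N : ℕ) (τ : ℝ) : ℝ := -(N / 2 : ℝ) * (max 1 τ) ^ (-(N / 2 : ℝ) - 1)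

theorem continuous_decayDeriv (N : ℕ) : Continuous (decayDeriv N) := by
  refine continuous_const.mul ((continuous_const.max continuous_id).rpow_const fun τ => Or.inl ?_)
  exact (lt_of_lt_of_le one_pos (le_max_left 1 τ)).ne'

theorem hasDerivAt_decay (N : ℕ) (τ : ℝ) : HasDerivAt (decay N) (decayDeriv N τ) τ := by
  have hlin : ∀ τ : ℝ, HasDerivAt (fun τ : ℝ => 1 - (N / 2 : ℝ) * (τ - 1)) (-(N / 2 : ℝ)) τ :=
    fun τ => by simpa using (((hasDerivAt_id τ).sub_const 1).const_mul (N / 2 : ℝ)).const_sub 1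
  have hpow : ∀ τ : ℝ, 1 ≤ τ → HasDerivAt (fun τ : ℝ => τ ^ (-(N / 2 : ℝ)))
      (-(N / 2 : ℝ) * τ ^ (-(N / 2 : ℝ) - 1)) τ :=
    fun τ h => Real.hasDerivAt_rpow_const (Or.inl (by linarith))
  rcases lt_trichotomy τ 1 with h | rfl | h
  · rw [decayDeriv, max_eq_left h.le, Real.one_rpow, mul_one]
    refine (hlin τ).congr_of_eventuallyEq ?_
    filter_upwards [Iio_mem_nhds h] with t ht
    exact if_pos (le_of_lt ht)
  · rw [decayDeriv, max_self]
    have h1 : HasDerivWithinAt (decay N) (-(N / 2 : ℝ) * 1 ^ (-(N / 2 : ℝ) - 1)) (Set.Iic 1) 1 := by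
      rw [Real.one_rpow, mul_one]
      exact (hlin 1).hasDerivWithinAt.congr (fun t ht => if_pos ht) (if_pos le_rfl)
    have h2 : HasDerivWithinAt (decay N) (-(N / 2 : ℝ) * 1 ^ (-(N / 2 : ℝ) - 1)) (Set.Ici 1) 1 := by
      have h1 : decay N 1 = 1 ^ (-(N / 2 : ℝ)) := by simp [decay]
      refine (hpow 1 le_rfl).hasDerivWithinAt.congr (fun t ht => ?_) h1
      rcases eq_or_lt_of_le (show (1 : ℝ) ≤ t from ht) with rfl | h
      · exact h1
      · exact if_neg (not_le.2 h)
    simpa using h1.union h2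
  · rw [decayDeriv, max_eq_right h.le]
    refine (hpow τ h.le).congr_of_eventuallyEq ?_
    filter_upwards [Ioi_mem_nhds h] with t ht
    exact if_neg (not_le.2 ht)

theorem continuous_decay (N : ℕ) : Continuous (decay N) :=
  continuous_iff_continuousAt.2 fun τ => (hasDerivAt_decay N τ).continuousAt

theorem decay_pos (N : ℕ) (τ : ℝ) : 0 < decay N τ := by
  rw [decay]
  split_ifs with h
  · have : (0 : ℝ) ≤ N / 2 * (1 - τ) := mul_nonneg (by positivity) (by linarith)
    linarith
  · exact Real.rpow_pos_of_pos (by linarith) _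

/-- The value `τ = 4` corresponds to `|x| = 2ε`, and `4^{-N/2} = 2^{-N}`. -/
theorem le_decay (N : ℕ) {τ : ℝ} (hτ : τ ≤ 4) : ((2 : ℝ) ^ N)⁻¹ ≤ decay N τ := by
  rw [decay]
  split_ifs with h
  · have : (0 : ℝ) ≤ N / 2 * (1 - τ) := mul_nonneg (by positivity) (by linarith)
    have h2 : ((2 : ℝ) ^ N)⁻¹ ≤ 1 := inv_le_one_of_one_le₀ (one_le_pow₀ (by norm_num))
    linarith
  · have h4 : ((2 : ℝ) ^ N)⁻¹ = 4 ^ (-(N / 2 : ℝ)) := by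
      rw [show (4 : ℝ) = 2 ^ (2 : ℝ) by norm_num, ← Real.rpow_mul (by norm_num),
        show (2 : ℝ) * -(N / 2 : ℝ) = -N by ring, Real.rpow_neg (by norm_num), Real.rpow_natCast]
    rw [h4]
    exact Real.rpow_le_rpow_of_nonpos (by linarith) hτ (by simp; positivity)

/-- The left side is the divergence of `decay N (|x|²/ε²) x`. It vanishes for `τ ≥ 1` because
`x/|x|^N` is divergence-free; the tangent line makes it non-negative for `τ ≤ 1` and continuous
across `τ = 1`. -/
theorem divergence_decay (N : ℕ) (τ : ℝ) :
    N * decay N τ + 2 * τ * decayDeriv N τ = N * (1 + N / 2) * max (1 - τ) 0 := by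
  rcases le_or_gt τ 1 with h | h
  · rw [decay, if_pos h, decayDeriv, max_eq_left h, Real.one_rpow, max_eq_left (by linarith)]
    ring
  · rw [decay, if_neg (not_le.2 h), decayDeriv, max_eq_right h.le, max_eq_right (by linarith),
      Real.rpow_sub_one (by linarith)]
    have : τ ≠ 0 := by linarith
    field_simp
    ring

/-! ### Construction of the concentrated solution. -/

/-- A radial solution whose weight is concentrated in the ball of radius `ε`. -/
theorem exists_concentrated_solution (N : ℕ) {p : ℝ} (hp : 1 < p) {ε R : ℝ} (hε : 0 < ε)
    (hR : 2 * ε ≤ R) :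
    ∃ w u : EuclideanSpace ℝ (Fin N) → ℝ, Measurable w ∧ (∀ x, 0 ≤ w x) ∧
      (∀ x, w x ≤ N * (1 + N / 2) * 2 ^ N * ε ^ (-p)) ∧ (∀ x, ε ≤ ‖x‖ → w x = 0) ∧
      (∀ x ∈ Metric.ball 0 R, 0 < u x) ∧ IsWeakSolution (Metric.ball 0 R) p w u := by
  have hR0 : 0 < R := by linarith
  have hp1 : 0 < p - 1 := by linarith
  have hq : 0 < 1 / (p - 1) := by positivity
  let a : ℝ → ℝ := fun t => decay N (t / ε ^ 2)
  let a' : ℝ → ℝ := fun t => decayDeriv N (t / ε ^ 2) / ε ^ 2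
  have hac : Continuous a := (continuous_decay N).comp (by fun_prop)
  have ha'c : Continuous a' := ((continuous_decayDeriv N).comp (by fun_prop)).div_const _
  have ha : ∀ t, HasDerivAt a (a' t) t := fun t => by
    have := (hasDerivAt_decay N (t / ε ^ 2)).comp t ((hasDerivAt_id t).div_const (ε ^ 2))
    simpa [a, a', Function.comp_def, div_eq_mul_inv] using this
  -- This is `-u'`, obtained by solving `g^{p-1} = r a(r²)`, the modulus of the prescribed flux.
  let g : ℝ → ℝ := fun r => (r * a (r ^ 2)) ^ (1 / (p - 1))
  have hgc : Continuous g := Continuous.rpow_const (by fun_prop) fun _ => Or.inr hq.le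
  have g0 : g 0 = 0 := by simp [g, hp1.ne']
  have hg : ∀ r, 0 < r → 0 < g r := fun r hr =>
    Real.rpow_pos_of_pos (mul_pos hr (decay_pos N _)) _
  have hgnn : ∀ r, 0 ≤ r → 0 ≤ g r := fun r hr =>
    Real.rpow_nonneg (mul_nonneg hr (decay_pos N _).le) _
  have hgp : ∀ r, 0 ≤ r → g r ^ (p - 1) = r * a (r ^ 2) := fun r hr => by
    simp only [g]
    rw [← Real.rpow_mul (mul_nonneg hr (decay_pos N _).le), one_div_mul_cancel hp1.ne',
      Real.rpow_one]
  let u : EuclideanSpace ℝ (Fin N) → ℝ := fun x => ∫ t in ‖x‖..R, g t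
  let G : EuclideanSpace ℝ (Fin N) → EuclideanSpace ℝ (Fin N) := fun x => (-g ‖x‖ / ‖x‖) • x
  have huc : Continuous u :=
    continuous_iff_continuousAt.2 fun x =>
      (hasGradientAt_integral_norm hgc g0 R x).differentiableAt.continuousAt
  have hu : ∀ x ∈ Metric.ball 0 R, 0 < u x := fun x hx => by
    have hx' : ‖x‖ < R := by simpa using hx
    exact intervalIntegral.intervalIntegral_pos_of_pos_on (hgc.intervalIntegrable _ _)
      (fun t ht => hg t ((norm_nonneg x).trans_lt ht.1)) hx'
  -- Only the part of the integral over `[ε, 2ε]` is kept, where `a ≥ 2^{-N}`; this is where `2ε ≤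
  -- R` enters, and it makes the bound independent of `R`.
  have hul : ∀ x : EuclideanSpace ℝ (Fin N), ‖x‖ ≤ ε → ε ^ p * (2 ^ N)⁻¹ ≤ u x ^ (p - 1) := by
    intro x hx
    have h1 : ∫ t in ε..(2 * ε), g t ≤ u x := by
      refine intervalIntegral.integral_mono_interval hx (by linarith) hR ?_
        (hgc.intervalIntegrable _ _)
      filter_upwards [ae_restrict_mem measurableSet_Ioc] with t ht
      exact hgnn t ((norm_nonneg x).trans ht.1.le)
    have h2 : ε * (ε * (2 ^ N)⁻¹) ^ (1 / (p - 1)) ≤ ∫ t in ε..(2 * ε), g t := by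
      have : ∫ t in ε..(2 * ε), (ε * (2 ^ N)⁻¹) ^ (1 / (p - 1)) =
          ε * (ε * (2 ^ N)⁻¹) ^ (1 / (p - 1)) := by
        rw [intervalIntegral.integral_const, smul_eq_mul]
        ring
      rw [← this]
      refine intervalIntegral.integral_mono_on (by linarith) intervalIntegrable_const
        (hgc.intervalIntegrable _ _) fun t ht => ?_
      refine Real.rpow_le_rpow (by positivity) ?_ hq.le
      refine mul_le_mul ht.1 (le_decay N ?_) (by positivity) (hε.le.trans ht.1)
      rw [div_le_iff₀ (by positivity)]
      nlinarith [ht.1, ht.2]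
    have h3 : (ε * (ε * (2 ^ N)⁻¹) ^ (1 / (p - 1))) ^ (p - 1) = ε ^ p * (2 ^ N)⁻¹ := by
      rw [Real.mul_rpow hε.le (by positivity), ← Real.rpow_mul (by positivity),
        one_div_mul_cancel hp1.ne', Real.rpow_one, ← mul_assoc, ← Real.rpow_add_one hε.ne',
        sub_add_cancel]
    rw [← h3]
    exact Real.rpow_le_rpow (by positivity) (h2.trans h1) hp1.le
  let f : EuclideanSpace ℝ (Fin N) → ℝ := fun x => N * (1 + N / 2) * max (1 - ‖x‖ ^ 2 / ε ^ 2) 0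
  have hfc : Continuous f := by fun_prop
  have hf0 : ∀ x, 0 ≤ f x := fun x => by positivity
  have hf1 : ∀ x, f x ≤ N * (1 + N / 2) := fun x => by
    refine mul_le_of_le_one_right (by positivity) (max_le ?_ zero_le_one)
    have : 0 ≤ ‖x‖ ^ 2 / ε ^ 2 := by positivity
    linarith
  have hfε : ∀ x, ε ≤ ‖x‖ → f x = 0 := fun x hx => by
    have : 1 ≤ ‖x‖ ^ 2 / ε ^ 2 := by
      rw [le_div_iff₀ (by positivity), one_mul]
      gcongr
    simp only [f]
    rw [max_eq_right (by linarith), mul_zero]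
  have hε2 : 0 < ε ^ p * ((2 : ℝ) ^ N)⁻¹ := by positivity
  -- The quotient is harmless where `u` is zero or negative: this happens only for `|x| ≥ R > ε`,
  -- where `f = 0`.
  refine ⟨fun x => f x / u x ^ (p - 1), u, hfc.measurable.div (huc.measurable.pow_const _),
    fun x => ?_, fun x => ?_, fun x hx => by simp [hfε x hx], hu, G,
    memW01p_integral_norm (by linarith) hgc g0 hR0, fun v H hv => ?_⟩
  · rcases le_total ε ‖x‖ with hx | hx
    · simp [hfε x hx]
    · exact div_nonneg (hf0 x) (hε2.le.trans (hul x hx))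
  · rcases le_total ε ‖x‖ with hx | hx
    · simp only [hfε x hx, zero_div]
      positivity
    · calc f x / u x ^ (p - 1) ≤ N * (1 + N / 2) / (ε ^ p * (2 ^ N)⁻¹) :=
            div_le_div₀ (by positivity) (hf1 x) hε2 (hul x hx)
        _ = N * (1 + N / 2) * 2 ^ N * ε ^ (-p) := by
            rw [Real.rpow_neg hε.le]
            field_simp
  · have hVc : Continuous fun x : EuclideanSpace ℝ (Fin N) => -(a (‖x‖ ^ 2) • x) := by fun_prop
    obtain ⟨C, hC⟩ := (isCompact_closedBall (0 : EuclideanSpace ℝ (Fin N)) R).exists_bound_of_continuousOn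
      hVc.continuousOn
    have hGV : ∀ x, ‖G x‖ ^ (p - 2) • G x = -(a (‖x‖ ^ 2) • x) := fun x => by
      rcases eq_or_ne x 0 with rfl | hx
      · simp [G]
      · have hn : 0 < ‖x‖ := norm_pos_iff.2 hx
        have h1 : ‖G x‖ = g ‖x‖ := by
          have := norm_div_norm_smul (h := fun r => -g r) (by simp [g0]) x
          simpa [G, abs_of_pos (hg _ hn)] using this
        have h2 : g ‖x‖ ^ (p - 2) * g ‖x‖ = ‖x‖ * a (‖x‖ ^ 2) := by
          rw [← Real.rpow_add_one (hg _ hn).ne', ← hgp _ hn.le]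
          congr 1
          ring
        rw [h1, smul_smul, ← neg_smul]
        congr 1
        rw [mul_div_assoc', mul_neg, h2]
        field_simp
    have hdiv : ∀ φ, IsTestFunction (Metric.ball 0 R) φ →
        ∫ x in Metric.ball 0 R, inner ℝ (-(a (‖x‖ ^ 2) • x)) (gradient φ x) =
          ∫ x in Metric.ball 0 R, f x * φ x := fun φ hφ => by
      simp_rw [inner_neg_left]
      rw [integral_neg, setIntegral_inner_smul_gradient_eq_neg ha ha'c hφ, neg_neg]
      congr 1
      ext x
      congr 1
      refine Eq.trans ?_ (divergence_decay N (‖x‖ ^ 2 / ε ^ 2))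
      simp only [a, a']
      ring
    have key := hv.integral_inner_eq hp.le measure_ball_lt_top.ne hVc.aestronglyMeasurable
      (by
        filter_upwards [ae_restrict_mem measurableSet_ball] with x hx
        exact hC x (Metric.ball_subset_closedBall hx))
      hfc.aestronglyMeasurable
      (Eventually.of_forall fun x => by
        rw [Real.norm_of_nonneg (hf0 x)]
        exact hf1 x) hdiv
    have hw : ∀ x ∈ Metric.ball 0 R,
        f x / u x ^ (p - 1) * (|u x| ^ (p - 2) * u x) * v x = f x * v x := fun x hx => by
      have hux := hu x hx
      rw [abs_of_pos hux, ← Real.rpow_add_one hux.ne', show p - 2 + 1 = p - 1 by ring,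
        div_mul_cancel₀ _ (Real.rpow_pos_of_pos hux _).ne']
    simp_rw [hGV]
    rw [integrableOn_congr_fun hw measurableSet_ball, setIntegral_congr_fun measurableSet_ball hw]
    exact key

/-! ### Norm estimate and choice of `ε`. -/

/-- The weight is at most a constant times `ε^{-p}` and lives on a ball of volume proportional to
`ε^N`, whence the exponent `N/τ - p`. Being bounded, it lies in `L^σ` for every `σ`. -/
theorem exists_const_lyapunovBoundFails {N : ℕ} (hN : 1 ≤ N) {p : ℝ} (hp : 1 < p) {τ : ℝ}
    (hτ : 0 < τ) : ∃ K > 0, ∀ σ C β R ε : ℝ, 0 < ε → 2 * ε ≤ R →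
      K * ε ^ (N / τ - p) < C / R ^ β → LyapunovBoundFails N p σ τ C β R := by
  have hN' : (0 : ℝ) < N := by exact_mod_cast hN
  let c : ℝ := (volume (Metric.ball (0 : EuclideanSpace ℝ (Fin N)) 1)).toReal
  have hc : 0 < c :=
    ENNReal.toReal_pos (Metric.measure_ball_pos volume _ one_pos).ne' measure_ball_lt_top.ne
  let K : ℝ := N * (1 + N / 2) * 2 ^ N
  have hK : 0 < K := by positivity
  refine ⟨K * c ^ τ⁻¹, by positivity, fun σ C β R ε hε hR hlt => ?_⟩
  obtain ⟨w, u, hwm, hw0, hwK, hwε, hu, hsol⟩ := exists_concentrated_solution N hp hε hR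
  have hball : volume (Metric.ball (0 : EuclideanSpace ℝ (Fin N)) R) ≠ 0 :=
    (Metric.measure_ball_pos volume _ (by linarith)).ne'
  have hwn : ∀ x, ‖w x‖ ≤ K * ε ^ (-p) := fun x => by
    rw [Real.norm_of_nonneg (hw0 x)]
    exact hwK x
  have : IsFiniteMeasure (volume.restrict (Metric.ball (0 : EuclideanSpace ℝ (Fin N)) R)) :=
    ⟨by simpa using measure_ball_lt_top⟩
  refine ⟨w, u, fun x _ => hw0 x,
    MemLp.of_bound hwm.aestronglyMeasurable _ (Eventually.of_forall hwn), hsol, fun h => ?_, ?_⟩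
  · have h0 : ∀ᵐ x ∂volume.restrict (Metric.ball (0 : EuclideanSpace ℝ (Fin N)) R), False := by
      filter_upwards [h, ae_restrict_mem measurableSet_ball] with x hx hxR
      exact (hu x hxR).ne' hx
    rw [eventually_false_iff_eq_bot, ae_eq_bot, Measure.restrict_eq_zero] at h0
    exact hball h0
  · rw [not_le]
    have hvol : volume (Metric.ball (0 : EuclideanSpace ℝ (Fin N)) ε) =
        ENNReal.ofReal (ε ^ N * c) := by
      rw [Measure.addHaar_ball_of_pos _ _ hε, ENNReal.ofReal_mul (by positivity),
        ENNReal.ofReal_toReal measure_ball_lt_top.ne]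
      simp
    have hind : w = (Metric.ball (0 : EuclideanSpace ℝ (Fin N)) ε).indicator w := by
      refine (Set.indicator_eq_self.2 fun x hx => ?_).symm
      by_contra h
      exact hx (hwε x (by simpa using h))
    calc eLpNorm w (ENNReal.ofReal τ) (volume.restrict (Metric.ball 0 R))
        ≤ eLpNorm w (ENNReal.ofReal τ) volume := eLpNorm_mono_measure _ Measure.restrict_le_self
      _ = eLpNorm w (ENNReal.ofReal τ) (volume.restrict (Metric.ball 0 ε)) := by
          conv_lhs => rw [hind]
          exact eLpNorm_indicator_eq_eLpNorm_restrict measurableSet_ball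
      _ ≤ (volume.restrict (Metric.ball (0 : EuclideanSpace ℝ (Fin N)) ε)) Set.univ ^
            (ENNReal.ofReal τ).toReal⁻¹ * ENNReal.ofReal (K * ε ^ (-p)) :=
          eLpNorm_le_of_ae_bound (Eventually.of_forall hwn)
      _ = ENNReal.ofReal (K * c ^ τ⁻¹ * ε ^ (N / τ - p)) := by
          rw [Measure.restrict_apply_univ, hvol, ENNReal.toReal_ofReal hτ.le,
            ENNReal.ofReal_rpow_of_nonneg (by positivity) (by positivity),
            ← ENNReal.ofReal_mul (by positivity)]
          congr 1
          rw [Real.mul_rpow (by positivity) hc.le, ← Real.rpow_natCast, ← Real.rpow_mul hε.le,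
            sub_eq_add_neg, Real.rpow_add hε, div_eq_mul_inv]
          ring
      _ < ENNReal.ofReal (C / R ^ β) :=
          (ENNReal.ofReal_lt_ofReal_iff_of_nonneg (by positivity)).2 hlt

theorem exists_forall_lt_rpow_lt {δ D : ℝ} (hδ : 0 < δ) (hD : 0 < D) :
    ∃ r > 0, ∀ ε, 0 < ε → ε < r → ε ^ δ < D := by
  refine ⟨D ^ δ⁻¹, by positivity, fun ε hε h => ?_⟩
  have := Real.rpow_lt_rpow hε.le h hδ
  rwa [← Real.rpow_mul hD.le, inv_mul_cancel₀ hδ.ne', Real.rpow_one] at this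

/-- Halving the radius: the bound fails as soon as `R^{β-γ}` is small, with `γ = p - N / τ`. -/
theorem exists_const_lyapunovBoundFails_of_rpow_lt {N : ℕ} (hN : 1 ≤ N) {p : ℝ} (hp : 1 < p)
    {τ : ℝ} (hτ : 0 < τ) {C : ℝ} (hC : 0 < C) : ∃ D > 0, ∀ σ β R : ℝ, 0 < R →
      R ^ (β - (p - N / τ)) < D → LyapunovBoundFails N p σ τ C β R := by
  obtain ⟨K, hK, h⟩ := exists_const_lyapunovBoundFails hN hp hτ
  -- The threshold comes from solving `K (R/2)^{N/τ-p} < C R^{-β}` for `R^{β-γ}`.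
  refine ⟨C / (K * 2⁻¹ ^ (N / τ - p)), by positivity, fun σ β R hR hlt =>
    h σ C β R (R * 2⁻¹) (by positivity) (by linarith) ?_⟩
  rw [lt_div_iff₀ (by positivity)] at hlt ⊢
  refine lt_of_eq_of_lt ?_ hlt
  rw [Real.mul_rpow hR.le (by norm_num), show β - (p - N / τ) = N / τ - p + β by ring,
    Real.rpow_add hR]
  ring

theorem exists_large_radius_lyapunovBoundFails {N : ℕ} (hN : 1 ≤ N) {p : ℝ} (hp : 1 < p)
    {τ : ℝ} (hτ : 0 < τ) {β C : ℝ} (hβ : β < p - N / τ) (hC : 0 < C) (σ : ℝ) :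
    ∃ R₀ ≥ 1, ∀ R > R₀, LyapunovBoundFails N p σ τ C β R := by
  obtain ⟨D, hD, h⟩ := exists_const_lyapunovBoundFails_of_rpow_lt hN hp hτ hC
  obtain ⟨r, hr, hlt⟩ := exists_forall_lt_rpow_lt (sub_pos.2 hβ) hD
  refine ⟨max 1 r⁻¹, le_max_left _ _, fun R hR => ?_⟩
  have hR0 : 0 < R := lt_of_lt_of_le one_pos ((le_max_left _ _).trans hR.le)
  refine h σ β R hR0 ?_
  -- Here `β - γ` is negative, so the smallness statement is applied to `R⁻¹` with the exponent `γ -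
  -- β`.
  have := hlt R⁻¹ (by positivity) (inv_lt_of_inv_lt₀ hr ((le_max_right _ _).trans_lt hR))
  rwa [Real.inv_rpow hR0.le, ← Real.rpow_neg hR0.le, neg_sub] at this

theorem exists_small_radius_lyapunovBoundFails {N : ℕ} (hN : 1 ≤ N) {p : ℝ} (hp : 1 < p)
    {τ : ℝ} (hτ : 0 < τ) {β C : ℝ} (hβ : p - N / τ < β) (hC : 0 < C) (σ : ℝ) :
    ∃ R₀ > 0, R₀ ≤ 1 ∧ ∀ R > 0, R < R₀ → LyapunovBoundFails N p σ τ C β R := by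
  obtain ⟨D, hD, h⟩ := exists_const_lyapunovBoundFails_of_rpow_lt hN hp hτ hC
  obtain ⟨r, hr, hlt⟩ := exists_forall_lt_rpow_lt (sub_pos.2 hβ) hD
  exact ⟨min 1 r, lt_min one_pos hr, min_le_left _ _, fun R hR0 hR =>
    h σ β R hR0 (hlt R hR0 (hR.trans_le (min_le_right _ _)))⟩

/-- For `p < N` the weight can be concentrated so that its `L^1` norm is arbitrarily small. -/
theorem lyapunovBoundFails_one {N : ℕ} (hN : 1 ≤ N) {p : ℝ} (hp : 1 < p) (hpN : p < N)
    {C R : ℝ} (hC : 0 < C) (hR : 0 < R) (σ β : ℝ) : LyapunovBoundFails N p σ 1 C β R := by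
  obtain ⟨K, hK, h⟩ := exists_const_lyapunovBoundFails hN hp one_pos
  obtain ⟨r, hr, hlt⟩ := exists_forall_lt_rpow_lt (δ := N / 1 - p) (D := C / R ^ β / K)
    (by simpa using hpN) (by positivity)
  have h1 := min_le_left r R
  have h2 := min_le_right r R
  have h3 : 0 < min r R := lt_min hr hR
  -- Halving the minimum secures both `ε < r` and `2ε ≤ R`.
  refine h σ C β R (min r R / 2) (by positivity) (by linarith) ?_
  have := hlt (min r R / 2) (by positivity) (by linarith)
  rwa [lt_div_iff₀ hK, mul_comm] at this

end Lyapunov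

theorem proposition2p7 (N : ℕ) (hN : 1 ≤ N) (p : ℝ) (hp : 1 < p) :
    -- the case `p > N`, with `γ = p - N`
    ((N : ℝ) < p →
      (∀ β < p - N, ∀ C > 0, ∃ R₀ ≥ 1, ∀ R > R₀, Lyapunov.LyapunovBoundFails N p 1 1 C β R) ∧
      (∀ β > p - N, ∀ C > 0, ∃ R₀ > 0, R₀ ≤ 1 ∧ ∀ R > 0, R < R₀ →
        Lyapunov.LyapunovBoundFails N p 1 1 C β R)) ∧
    -- the case `p < N`, with `γ = (s p - N) / s`
    (p < (N : ℝ) → ∀ s > (N : ℝ) / p,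
      -- the `L^s` norm
      (∀ β < (s * p - N) / s, ∀ C > 0, ∃ R₀ ≥ 1, ∀ R > R₀,
        Lyapunov.LyapunovBoundFails N p s s C β R) ∧
      (∀ β > (s * p - N) / s, ∀ C > 0, ∃ R₀ > 0, R₀ ≤ 1 ∧ ∀ R > 0, R < R₀ →
        Lyapunov.LyapunovBoundFails N p s s C β R) ∧
      -- the `L^1` norm, where no restriction on the radius beyond `R > 1`, `R < 1` is needed
      (∀ R > 1, ∀ β < (s * p - N) / s, ∀ C > 0, Lyapunov.LyapunovBoundFails N p s 1 C β R) ∧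
      (∀ R > 0, R < 1 → ∀ β > (s * p - N) / s, ∀ C > 0,
        Lyapunov.LyapunovBoundFails N p s 1 C β R)) := by
  -- Both values of `γ` are `p - N/τ`, with `τ = 1` and `τ = s`.
  have h1 : p - (N : ℝ) = p - N / 1 := by rw [div_one]
  refine ⟨fun _ => ⟨fun β hβ C hC => ?_, fun β hβ C hC => ?_⟩, fun hpN s hs => ?_⟩
  · exact Lyapunov.exists_large_radius_lyapunovBoundFails hN hp one_pos (h1 ▸ hβ) hC 1
  · exact Lyapunov.exists_small_radius_lyapunovBoundFails hN hp one_pos (h1 ▸ hβ) hC 1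
  · have hs0 : 0 < s := lt_of_le_of_lt (by positivity) hs
    have h2 : (s * p - N) / s = p - N / s := by field_simp
    rw [h2]
    refine ⟨fun β hβ C hC => ?_, fun β hβ C hC => ?_, fun R hR β _ C hC => ?_,
      fun R hR _ β _ C hC => ?_⟩
    · exact Lyapunov.exists_large_radius_lyapunovBoundFails hN hp hs0 hβ hC s
    · exact Lyapunov.exists_small_radius_lyapunovBoundFails hN hp hs0 hβ hC s
    · exact Lyapunov.lyapunovBoundFails_one hN hp hpN hC (by linarith) s β
    · exact Lyapunov.lyapunovBoundFails_one hN hp hpN hC hR s β
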